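/- Let $\mathcal{A}$ be a set of actions, let $\tau\notin\mathcal{A}$ and $\mathcal{A}_\tau=\mathcal{A}\cup\{\tau\}$. Process expressions are generated by $$P ::= \mathbf{0}\mid \alpha.P\mid P+P\mid P\parallel P\mid \alpha^*P\qquad(\alpha\in\mathcal{A}_\tau).$$ The transition relations $\xrightarrow{\alpha}$ ($\alpha\in\mathcal{A}_\tau$) are the least relations such that: $\alpha.P\xrightarrow{\alpha}P$; if $P\xrightarrow{\alpha}P'$, then $P+Q\xrightarrow{\alpha}P'$, $Q+P\xrightarrow{\alpha}P'$, $P\parallel Q\xrightarrow{\alpha}P'\parallel Q$ and $Q\parallel P\xrightarrow{\alpha}Q\parallel P'$; $\alpha^*P\xrightarrow{\alpha}\alpha^*P$; and if $P\xrightarrow{\beta}P'$, then $\alpha^*P\xrightarrow{\beta}P'$. Let $\twoheadrightarrow$ be the reflexive-transitive closure of $\xrightarrow{\tau}$, and write $P\xrightarrow{(\alpha)}P'$ if $P\xrightarrow{\alpha}P'$, or $\alpha=\tau$ and $P=P'$. A symmetric relation $R$ on process expressions is a branching bisimulation if $P\mathrel{R}Q$ and $P\xrightarrow{\alpha}P'$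 imply that there are $Q'',Q'$ with $Q\twoheadrightarrow Q''\xrightarrow{(\alpha)}Q'$, $P\mathrel{R}Q''$ and $P'\mathrel{R}Q'$. It is a weak bisimulation if $P\mathrel{R}Q$ and $P\xrightarrow{\alpha}P'$ imply that there are $Q'',Q''',Q'$ with $Q\twoheadrightarrow Q''\xrightarrow{(\alpha)}Q'''\twoheadrightarrow Q'$ and $P'\mathrel{R}Q'$. Two process expressions are branching (weakly) bisimilar if they are related by some branching (weak) bisimulation. Each of these two relations is an equivalence compatible with $\parallel$, and the equivalence classes $[P]$ form a commutative monoid under $[P]\parallel[Q]=[P\parallel Q]$ with identity $\mathbf{0}=[\mathbf{0}]$. For $a\in\mathcal{A}$ write $P\overset{a}{\twoheadrightarrow}Q$ if $P\twoheadrightarrow P'\xrightarrow{a}Q'\twoheadrightarrow Q$ for some $P',Q'$. A process expression $P$ is weakly bounded if there is $k\in\mathbb{N}$ such that $\ell\le k$ for every sequence $P\overset{a_1}{\twoheadrightarrow}P_1\cdots\overset{a_\ell}{\twoheadrightarrow}P_\ell$ with $a_1,\dots,a_\ell\in\mathcal{A}$. Let $\mathbf{B}_{\mathrm{fin}}$ and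 $\mathbf{W}_{\mathrm{fin}}$ be the commutative submonoids of classes of weakly bounded process expressions modulo branching and weak bisimilarity, respectively. On classes, write $x\to x'$ if $Q\xrightarrow{\alpha}Q'$ for some $Q\in x$, $Q'\in x'$ and $\alpha\in\mathcal{A}_\tau$. Let $x\preccurlyeq y$ mean that $y\to^* x$, where $\to^*$ is the reflexive-transitive closure of $\to$, and let $x\prec y$ mean $x\preccurlyeq y$ and $x\ne y$. A partial order $\preccurlyeq$ on a commutative monoid $M$ with identity $e$ is a weak decomposition order if it is well-founded (every non-empty subset of $M$ has a minimal element), $e$ is its least element, $x\preccurlyeq y$ implies $xz\preccurlyeq yz$, $x\preccurlyeq yz$ implies $x=y'z'$ for some $y'\preccurlyeq y$ and $z'\preccurlyeq z$, and ($x^n\preccurlyeq y$ for all $n\in\mathbb{N}$) implies $x=e$. An element $p\in M$ is indecomposable if $p\ne e$ and $p=xy$ implies $x=e$ or $y=e$. A weak decomposition order $\preccurlyeq$ on $M$ satisfies power cancellation if for all $x,y\in M$, every indecomposable $p\in M$ with $p\not\prec x$ and $p\not\prec y$, and every $k\in\mathbb{N}$: if $p^kx=p^ky$, then $x=y$. **Proposition.**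 On each of the monoids $\mathbf{B}_{\mathrm{fin}}$ and $\mathbf{W}_{\mathrm{fin}}$, the relation $\preccurlyeq$ is a weak decomposition order that satisfies power cancellation. -/

import Mathlib

namespace BCCS

universe u

/-- Process expressions over a set `Act` of actions. The set of actions together with the
silent action `τ` is `Option Act`, where `none` is `τ` and `some a` is the action `a`. -/
inductive Proc (Act : Type u) : Type u where
  | nil : Proc Act
  | pre : Option Act → Proc Act → Proc Act
  | alt : Proc Act → Proc Act → Proc Act
  | par : Proc Act → Proc Act → Proc Act
  | star : Option Act → Proc Act → Proc Act

/-- The operational semantics. -/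
inductive Step {Act : Type u} : Proc Act → Option Act → Proc Act → Prop where
  | pre (α : Option Act) (P : Proc Act) : Step (.pre α P) α P
  | altLeft {P P' : Proc Act} {α : Option Act} (Q : Proc Act) :
      Step P α P' → Step (.alt P Q) α P'
  | altRight {Q Q' : Proc Act} {α : Option Act} (P : Proc Act) :
      Step Q α Q' → Step (.alt P Q) α Q'
  | parLeft {P P' : Proc Act} {α : Option Act} (Q : Proc Act) :
      Step P α P' → Step (.par P Q) α (.par P' Q)
  | parRight {Q Q' : Proc Act} {α : Option Act} (P : Proc Act) :
      Step Q α Q' → Step (.par P Q) α (.par P Q')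
  | starLoop (α : Option Act) (P : Proc Act) : Step (.star α P) α (.star α P)
  | starExit {P P' : Proc Act} {β : Option Act} (α : Option Act) :
      Step P β P' → Step (.star α P) β P'

variable {Act : Type u}

/-- Zero or more silent transitions. -/
def SilentSteps : Proc Act → Proc Act → Prop :=
  Relation.ReflTransGen (fun P P' => Step P none P')

/-- An `α`-transition, or nothing at all if `α` is silent. -/
def OptStep (P : Proc Act) (α : Option Act) (P' : Proc Act) : Prop :=
  Step P α P' ∨ (α = none ∧ P = P')

/-- Branching bisimulations. -/
def IsBranchingBisimulation (R : Proc Act → Proc Act → Prop) : Prop :=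
  (∀ P Q, R P Q → R Q P) ∧
  ∀ P Q α P', R P Q → Step P α P' →
    ∃ Q'' Q', SilentSteps Q Q'' ∧ OptStep Q'' α Q' ∧ R P Q'' ∧ R P' Q'

/-- Branching bisimilarity. -/
def BranchingBisimilar (P Q : Proc Act) : Prop :=
  ∃ R, IsBranchingBisimulation R ∧ R P Q

/-- Weak bisimulations. -/
def IsWeakBisimulation (R : Proc Act → Proc Act → Prop) : Prop :=
  (∀ P Q, R P Q → R Q P) ∧
  ∀ P Q α P', R P Q → Step P α P' →
    ∃ Q'' Q''' Q', SilentSteps Q Q'' ∧ OptStep Q'' α Q''' ∧ SilentSteps Q''' Q' ∧ R P' Q'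

/-- Weak bisimilarity. -/
def WeaklyBisimilar (P Q : Proc Act) : Prop :=
  ∃ R, IsWeakBisimulation R ∧ R P Q

/-- `P` weakly performs the (observable) action `a`: silent transitions, an `a`-transition,
silent transitions. -/
def WeakStep (P : Proc Act) (a : Act) (Q : Proc Act) : Prop :=
  ∃ P' Q', SilentSteps P P' ∧ Step P' (some a) Q' ∧ SilentSteps Q' Q

/-- `WeakPath P ℓ Q`: there is a sequence of `ℓ` weak observable steps from `P` to `Q`. -/
inductive WeakPath : Proc Act → ℕ → Proc Act → Prop where
  | refl (P : Proc Act) : WeakPath P 0 P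
  | cons {P Q S : Proc Act} {a : Act} {l : ℕ} :
      WeakStep P a Q → WeakPath Q l S → WeakPath P (l + 1) S

/-- `P` is weakly bounded by `k`. -/
def WeaklyBoundedBy (k : ℕ) (P : Proc Act) : Prop :=
  ∀ l Q, WeakPath P l Q → l ≤ k

/-- `P` is weakly bounded. -/
def WeaklyBounded (P : Proc Act) : Prop :=
  ∃ k, WeaklyBoundedBy k P

/-! ### Bisimilarities are equivalences and compatible with parallel composition -/

theorem SilentSteps.parBoth {P P' Q Q' : Proc Act} (h : SilentSteps P P')
    (h' : SilentSteps Q Q') : SilentSteps (.par P Q) (.par P' Q') := by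
  have h1 : SilentSteps (.par P Q) (.par P' Q) := by
    induction h with
    | refl => exact Relation.ReflTransGen.refl
    | tail _ hs ih => exact ih.tail (Step.parLeft Q hs)
  have h2 : SilentSteps (.par P' Q) (.par P' Q') := by
    induction h' with
    | refl => exact Relation.ReflTransGen.refl
    | tail _ hs ih => exact ih.tail (Step.parRight P' hs)
  exact Relation.ReflTransGen.trans h1 h2

theorem OptStep.parLeft {P P' : Proc Act} {α : Option Act} (Q : Proc Act)
    (h : OptStep P α P') : OptStep (.par P Q) α (.par P' Q) := by
  rcases h with h | ⟨h, rfl⟩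
  · exact Or.inl (Step.parLeft Q h)
  · exact Or.inr ⟨h, rfl⟩

theorem OptStep.parRight {Q Q' : Proc Act} {α : Option Act} (P : Proc Act)
    (h : OptStep Q α Q') : OptStep (.par P Q) α (.par P Q') := by
  rcases h with h | ⟨h, rfl⟩
  · exact Or.inl (Step.parRight P h)
  · exact Or.inr ⟨h, rfl⟩

theorem OptStep.silentSteps {P P' : Proc Act} (h : OptStep P none P') : SilentSteps P P' := by
  rcases h with h | ⟨_, rfl⟩
  · exact Relation.ReflTransGen.single h
  · exact Relation.ReflTransGen.refl

theorem IsBranchingBisimulation.isWeakBisimulation {R : Proc Act → Proc Act → Prop}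
    (h : IsBranchingBisimulation R) : IsWeakBisimulation R := by
  refine ⟨h.1, fun P Q α P' hPQ hs => ?_⟩
  obtain ⟨Q'', Q', h1, h2, _, h4⟩ := h.2 P Q α P' hPQ hs
  exact ⟨Q'', Q', Q', h1, h2, Relation.ReflTransGen.refl, h4⟩

theorem BranchingBisimilar.weaklyBisimilar {P Q : Proc Act} (h : BranchingBisimilar P Q) :
    WeaklyBisimilar P Q :=
  let ⟨R, hR, hPQ⟩ := h
  ⟨R, hR.isWeakBisimulation, hPQ⟩

theorem branchingBisimilar_of_strong {R : Proc Act → Proc Act → Prop}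
    (h1 : ∀ P Q α P', R P Q → Step P α P' → ∃ Q', Step Q α Q' ∧ R P' Q')
    (h2 : ∀ P Q α Q', R P Q → Step Q α Q' → ∃ P', Step P α P' ∧ R P' Q')
    {P Q : Proc Act} (h : R P Q) : BranchingBisimilar P Q := by
  refine ⟨fun P Q => R P Q ∨ R Q P, ⟨fun P Q h => h.symm, ?_⟩, Or.inl h⟩
  rintro P Q α P' (hR | hR) hs
  · obtain ⟨Q', hQ, hR'⟩ := h1 _ _ _ _ hR hs
    exact ⟨Q, Q', Relation.ReflTransGen.refl, Or.inl hQ, Or.inl hR, Or.inl hR'⟩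
  · obtain ⟨Q', hQ, hR'⟩ := h2 _ _ _ _ hR hs
    exact ⟨Q, Q', Relation.ReflTransGen.refl, Or.inl hQ, Or.inr hR, Or.inr hR'⟩

theorem IsBranchingBisimulation.silentSteps {R : Proc Act → Proc Act → Prop}
    (h : IsBranchingBisimulation R) {P Q P' : Proc Act} (hPQ : R P Q) (hs : SilentSteps P P') :
    ∃ Q', SilentSteps Q Q' ∧ R P' Q' := by
  induction hs with
  | refl => exact ⟨Q, Relation.ReflTransGen.refl, hPQ⟩
  | tail _ hs ih =>
    obtain ⟨Q1, hQ1, hR1⟩ := ih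
    obtain ⟨Q'', Q', h1, h2, _, h4⟩ := h.2 _ _ _ _ hR1 hs
    exact ⟨Q', hQ1.trans (h1.trans h2.silentSteps), h4⟩

theorem IsWeakBisimulation.silentSteps {R : Proc Act → Proc Act → Prop}
    (h : IsWeakBisimulation R) {P Q P' : Proc Act} (hPQ : R P Q) (hs : SilentSteps P P') :
    ∃ Q', SilentSteps Q Q' ∧ R P' Q' := by
  induction hs with
  | refl => exact ⟨Q, Relation.ReflTransGen.refl, hPQ⟩
  | tail _ hs ih =>
    obtain ⟨Q1, hQ1, hR1⟩ := ih
    obtain ⟨Q'', Q''', Q', h1, h2, h3, h4⟩ := h.2 _ _ _ _ hR1 hs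
    exact ⟨Q', hQ1.trans (h1.trans (h2.silentSteps.trans h3)), h4⟩

theorem branchingBisimilar_equivalence : Equivalence (BranchingBisimilar (Act := Act)) := by
  refine ⟨fun P => ?_, ?_, ?_⟩
  · refine branchingBisimilar_of_strong (R := Eq) ?_ ?_ rfl
    · rintro P _ α P' rfl hs
      exact ⟨P', hs, rfl⟩
    · rintro P _ α P' rfl hs
      exact ⟨P', hs, rfl⟩
  · rintro P Q ⟨R, hR, h⟩
    exact ⟨R, hR, hR.1 _ _ h⟩
  · have key : ∀ R S : Proc Act → Proc Act → Prop, IsBranchingBisimulation R →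
        IsBranchingBisimulation S → ∀ P M Q α P', R P M → S M Q → Step P α P' →
        ∃ Q'' Q', SilentSteps Q Q'' ∧ OptStep Q'' α Q' ∧ (∃ M, R P M ∧ S M Q'') ∧
          (∃ M, R P' M ∧ S M Q') := by
      intro R S hR hS P M Q α P' h1 h2 hs
      obtain ⟨M'', M', hM, hα, hr1, hr2⟩ := hR.2 _ _ _ _ h1 hs
      obtain ⟨Q1, hQ1, hS1⟩ := hS.silentSteps h2 hM
      rcases hα with hα | ⟨rfl, rfl⟩
      · obtain ⟨Q'', Q', h3, h4, h5, h6⟩ := hS.2 _ _ _ _ hS1 hα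
        exact ⟨Q'', Q', hQ1.trans h3, h4, ⟨M'', hr1, h5⟩, ⟨M', hr2, h6⟩⟩
      · exact ⟨Q1, Q1, hQ1, Or.inr ⟨rfl, rfl⟩, ⟨M'', hr1, hS1⟩, ⟨M'', hr2, hS1⟩⟩
    rintro P Q T ⟨R, hR, hPQ⟩ ⟨S, hS, hQT⟩
    refine ⟨fun P Q => (∃ M, R P M ∧ S M Q) ∨ (∃ M, S P M ∧ R M Q), ⟨?_, ?_⟩,
      Or.inl ⟨Q, hPQ, hQT⟩⟩
    · rintro P Q (⟨M, h1, h2⟩ | ⟨M, h1, h2⟩)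
      · exact Or.inr ⟨M, hS.1 _ _ h2, hR.1 _ _ h1⟩
      · exact Or.inl ⟨M, hR.1 _ _ h2, hS.1 _ _ h1⟩
    · rintro P Q α P' (⟨M, h1, h2⟩ | ⟨M, h1, h2⟩) hs
      · obtain ⟨Q'', Q', h3, h4, h5, h6⟩ := key R S hR hS P M Q α P' h1 h2 hs
        exact ⟨Q'', Q', h3, h4, Or.inl h5, Or.inl h6⟩
      · obtain ⟨Q'', Q', h3, h4, h5, h6⟩ := key S R hS hR P M Q α P' h1 h2 hs
        exact ⟨Q'', Q', h3, h4, Or.inr h5, Or.inr h6⟩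

theorem weaklyBisimilar_equivalence : Equivalence (WeaklyBisimilar (Act := Act)) := by
  refine ⟨fun P => (branchingBisimilar_equivalence.refl P).weaklyBisimilar, ?_, ?_⟩
  · rintro P Q ⟨R, hR, h⟩
    exact ⟨R, hR, hR.1 _ _ h⟩
  · have key : ∀ R S : Proc Act → Proc Act → Prop, IsWeakBisimulation R →
        IsWeakBisimulation S → ∀ P M Q α P', R P M → S M Q → Step P α P' →
        ∃ Q'' Q''' Q', SilentSteps Q Q'' ∧ OptStep Q'' α Q''' ∧ SilentSteps Q''' Q' ∧
          (∃ M, R P' M ∧ S M Q') := by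
      intro R S hR hS P M Q α P' h1 h2 hs
      obtain ⟨M'', M''', M', hM, hα, hM', hr⟩ := hR.2 _ _ _ _ h1 hs
      obtain ⟨Q1, hQ1, hS1⟩ := hS.silentSteps h2 hM
      rcases hα with hα | ⟨rfl, rfl⟩
      · obtain ⟨Q'', Q''', Q', h3, h4, h5, h6⟩ := hS.2 _ _ _ _ hS1 hα
        obtain ⟨Q2, hQ2, hS2⟩ := hS.silentSteps h6 hM'
        exact ⟨Q'', Q''', Q2, hQ1.trans h3, h4, h5.trans hQ2, ⟨M', hr, hS2⟩⟩
      · obtain ⟨Q2, hQ2, hS2⟩ := hS.silentSteps hS1 hM'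
        exact ⟨Q1, Q1, Q2, hQ1, Or.inr ⟨rfl, rfl⟩, hQ2, ⟨M', hr, hS2⟩⟩
    rintro P Q T ⟨R, hR, hPQ⟩ ⟨S, hS, hQT⟩
    refine ⟨fun P Q => (∃ M, R P M ∧ S M Q) ∨ (∃ M, S P M ∧ R M Q), ⟨?_, ?_⟩,
      Or.inl ⟨Q, hPQ, hQT⟩⟩
    · rintro P Q (⟨M, h1, h2⟩ | ⟨M, h1, h2⟩)
      · exact Or.inr ⟨M, hS.1 _ _ h2, hR.1 _ _ h1⟩
      · exact Or.inl ⟨M, hR.1 _ _ h2, hS.1 _ _ h1⟩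
    · rintro P Q α P' (⟨M, h1, h2⟩ | ⟨M, h1, h2⟩) hs
      · obtain ⟨Q'', Q''', Q', h3, h4, h5, h6⟩ := key R S hR hS P M Q α P' h1 h2 hs
        exact ⟨Q'', Q''', Q', h3, h4, h5, Or.inl h6⟩
      · obtain ⟨Q'', Q''', Q', h3, h4, h5, h6⟩ := key S R hS hR P M Q α P' h1 h2 hs
        exact ⟨Q'', Q''', Q', h3, h4, h5, Or.inr h6⟩

theorem BranchingBisimilar.par {P₁ P₂ Q₁ Q₂ : Proc Act} (h₁ : BranchingBisimilar P₁ Q₁)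
    (h₂ : BranchingBisimilar P₂ Q₂) : BranchingBisimilar (.par P₁ P₂) (.par Q₁ Q₂) := by
  refine ⟨fun P Q => ∃ P₁ P₂ Q₁ Q₂, P = .par P₁ P₂ ∧ Q = .par Q₁ Q₂ ∧
    BranchingBisimilar P₁ Q₁ ∧ BranchingBisimilar P₂ Q₂, ⟨?_, ?_⟩,
    ⟨P₁, P₂, Q₁, Q₂, rfl, rfl, h₁, h₂⟩⟩
  · rintro _ _ ⟨P₁, P₂, Q₁, Q₂, rfl, rfl, h₁, h₂⟩
    exact ⟨_, _, _, _, rfl, rfl, branchingBisimilar_equivalence.symm h₁,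
      branchingBisimilar_equivalence.symm h₂⟩
  · rintro _ _ α P' ⟨P₁, P₂, Q₁, Q₂, rfl, rfl, h₁, h₂⟩ hs
    cases hs with
    | parLeft _ hs =>
      obtain ⟨R, hR, hPQ⟩ := h₁
      obtain ⟨Q'', Q', h3, h4, h5, h6⟩ := hR.2 _ _ _ _ hPQ hs
      exact ⟨_, _, h3.parBoth Relation.ReflTransGen.refl, h4.parLeft Q₂,
        ⟨_, _, _, _, rfl, rfl, ⟨R, hR, h5⟩, h₂⟩, ⟨_, _, _, _, rfl, rfl, ⟨R, hR, h6⟩, h₂⟩⟩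
    | parRight _ hs =>
      obtain ⟨R, hR, hPQ⟩ := h₂
      obtain ⟨Q'', Q', h3, h4, h5, h6⟩ := hR.2 _ _ _ _ hPQ hs
      exact ⟨_, _, SilentSteps.parBoth Relation.ReflTransGen.refl h3, h4.parRight Q₁,
        ⟨_, _, _, _, rfl, rfl, h₁, ⟨R, hR, h5⟩⟩, ⟨_, _, _, _, rfl, rfl, h₁, ⟨R, hR, h6⟩⟩⟩

theorem WeaklyBisimilar.par {P₁ P₂ Q₁ Q₂ : Proc Act} (h₁ : WeaklyBisimilar P₁ Q₁)
    (h₂ : WeaklyBisimilar P₂ Q₂) : WeaklyBisimilar (.par P₁ P₂) (.par Q₁ Q₂) := by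
  refine ⟨fun P Q => ∃ P₁ P₂ Q₁ Q₂, P = .par P₁ P₂ ∧ Q = .par Q₁ Q₂ ∧
    WeaklyBisimilar P₁ Q₁ ∧ WeaklyBisimilar P₂ Q₂, ⟨?_, ?_⟩,
    ⟨P₁, P₂, Q₁, Q₂, rfl, rfl, h₁, h₂⟩⟩
  · rintro _ _ ⟨P₁, P₂, Q₁, Q₂, rfl, rfl, h₁, h₂⟩
    exact ⟨_, _, _, _, rfl, rfl, weaklyBisimilar_equivalence.symm h₁,
      weaklyBisimilar_equivalence.symm h₂⟩
  · rintro _ _ α P' ⟨P₁, P₂, Q₁, Q₂, rfl, rfl, h₁, h₂⟩ hs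
    cases hs with
    | parLeft _ hs =>
      obtain ⟨R, hR, hPQ⟩ := h₁
      obtain ⟨Q'', Q''', Q', h3, h4, h5, h6⟩ := hR.2 _ _ _ _ hPQ hs
      exact ⟨_, _, _, h3.parBoth Relation.ReflTransGen.refl, h4.parLeft Q₂,
        h5.parBoth Relation.ReflTransGen.refl, ⟨_, _, _, _, rfl, rfl, ⟨R, hR, h6⟩, h₂⟩⟩
    | parRight _ hs =>
      obtain ⟨R, hR, hPQ⟩ := h₂
      obtain ⟨Q'', Q''', Q', h3, h4, h5, h6⟩ := hR.2 _ _ _ _ hPQ hs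
      exact ⟨_, _, _, SilentSteps.parBoth Relation.ReflTransGen.refl h3, h4.parRight Q₁,
        SilentSteps.parBoth Relation.ReflTransGen.refl h5,
        ⟨_, _, _, _, rfl, rfl, h₁, ⟨R, hR, h6⟩⟩⟩

theorem branchingBisimilar_par_comm (P Q : Proc Act) :
    BranchingBisimilar (.par P Q) (.par Q P) := by
  refine branchingBisimilar_of_strong
    (R := fun X Y => ∃ P Q, X = Proc.par P Q ∧ Y = Proc.par Q P) ?_ ?_ ⟨P, Q, rfl, rfl⟩
  all_goals
    rintro _ _ α X ⟨P, Q, rfl, rfl⟩ hs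
    cases hs with
    | parLeft _ hs => exact ⟨_, Step.parRight _ hs, _, _, rfl, rfl⟩
    | parRight _ hs => exact ⟨_, Step.parLeft _ hs, _, _, rfl, rfl⟩

theorem branchingBisimilar_par_assoc (P Q T : Proc Act) :
    BranchingBisimilar (.par (.par P Q) T) (.par P (.par Q T)) := by
  refine branchingBisimilar_of_strong
    (R := fun X Y => ∃ P Q T, X = Proc.par (.par P Q) T ∧ Y = Proc.par P (.par Q T)) ?_ ?_
    ⟨P, Q, T, rfl, rfl⟩
  · rintro _ _ α X ⟨P, Q, T, rfl, rfl⟩ hs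
    cases hs with
    | parLeft _ hs =>
      cases hs with
      | parLeft _ hs => exact ⟨_, Step.parLeft _ hs, _, _, _, rfl, rfl⟩
      | parRight _ hs => exact ⟨_, Step.parRight _ (Step.parLeft _ hs), _, _, _, rfl, rfl⟩
    | parRight _ hs => exact ⟨_, Step.parRight _ (Step.parRight _ hs), _, _, _, rfl, rfl⟩
  · rintro _ _ α X ⟨P, Q, T, rfl, rfl⟩ hs
    cases hs with
    | parLeft _ hs => exact ⟨_, Step.parLeft _ (Step.parLeft _ hs), _, _, _, rfl, rfl⟩
    | parRight _ hs =>
      cases hs with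
      | parLeft _ hs => exact ⟨_, Step.parLeft _ (Step.parRight _ hs), _, _, _, rfl, rfl⟩
      | parRight _ hs => exact ⟨_, Step.parRight _ hs, _, _, _, rfl, rfl⟩

theorem branchingBisimilar_par_nil (P : Proc Act) :
    BranchingBisimilar (.par P .nil) P := by
  refine branchingBisimilar_of_strong (R := fun X Y => X = Proc.par Y .nil) ?_ ?_ rfl
  · rintro _ Q α X rfl hs
    cases hs with
    | parLeft _ hs => exact ⟨_, hs, rfl⟩
    | parRight _ hs => cases hs
  · rintro _ Q α X rfl hs
    exact ⟨_, Step.parLeft _ hs, rfl⟩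

/-! ### Weakly bounded processes are closed under parallel composition -/

theorem SilentSteps.of_par {P Q X : Proc Act} (h : SilentSteps (.par P Q) X) :
    ∃ P' Q', X = .par P' Q' ∧ SilentSteps P P' ∧ SilentSteps Q Q' := by
  induction h with
  | refl => exact ⟨P, Q, rfl, Relation.ReflTransGen.refl, Relation.ReflTransGen.refl⟩
  | tail _ hs ih =>
    obtain ⟨P', Q', rfl, h1, h2⟩ := ih
    cases hs with
    | parLeft _ hs => exact ⟨_, _, rfl, h1.tail hs, h2⟩
    | parRight _ hs => exact ⟨_, _, rfl, h1, h2.tail hs⟩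

theorem WeakPath.of_silentSteps {P P' Q : Proc Act} {l : ℕ} (h : SilentSteps P P')
    (h' : WeakPath P' l Q) : ∃ Q', WeakPath P l Q' := by
  cases h' with
  | refl => exact ⟨P, .refl P⟩
  | cons hs hp =>
    obtain ⟨X, Y, h1, h2, h3⟩ := hs
    exact ⟨Q, .cons ⟨X, Y, h.trans h1, h2, h3⟩ hp⟩

theorem WeakPath.of_par {X Y : Proc Act} {l : ℕ} (h : WeakPath X l Y) :
    ∀ P Q, X = .par P Q →
      ∃ m n P' Q', l = m + n ∧ WeakPath P m P' ∧ WeakPath Q n Q' := by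
  induction h with
  | refl X => exact fun P Q _ => ⟨0, 0, P, Q, rfl, .refl P, .refl Q⟩
  | cons hs _ ih =>
    rintro P Q rfl
    obtain ⟨X, Y, h1, h2, h3⟩ := hs
    obtain ⟨P₁, Q₁, rfl, hP₁, hQ₁⟩ := h1.of_par
    cases h2 with
    | parLeft _ h2 =>
      obtain ⟨P₂, Q₂, rfl, hP₂, hQ₂⟩ := h3.of_par
      obtain ⟨m, n, P', Q', rfl, hm, hn⟩ := ih _ _ rfl
      obtain ⟨Q'', hn'⟩ := hn.of_silentSteps (hQ₁.trans hQ₂)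
      exact ⟨m + 1, n, P', Q'', by omega, .cons ⟨_, _, hP₁, h2, hP₂⟩ hm, hn'⟩
    | parRight _ h2 =>
      obtain ⟨P₂, Q₂, rfl, hP₂, hQ₂⟩ := h3.of_par
      obtain ⟨m, n, P', Q', rfl, hm, hn⟩ := ih _ _ rfl
      obtain ⟨P'', hm'⟩ := hm.of_silentSteps (hP₁.trans hP₂)
      exact ⟨m, n + 1, P'', Q', by omega, hm', .cons ⟨_, _, hQ₁, h2, hQ₂⟩ hn⟩

theorem weaklyBounded_nil : WeaklyBounded (.nil : Proc Act) := by
  refine ⟨0, fun l Q h => ?_⟩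
  cases h with
  | refl => exact le_rfl
  | cons hs _ =>
    obtain ⟨X, Y, h1, h2, _⟩ := hs
    rcases Relation.ReflTransGen.cases_head h1 with rfl | ⟨Z, hZ, _⟩
    · cases h2
    · cases hZ

theorem WeaklyBounded.par {P Q : Proc Act} (hP : WeaklyBounded P) (hQ : WeaklyBounded Q) :
    WeaklyBounded (.par P Q) := by
  obtain ⟨k, hk⟩ := hP
  obtain ⟨k', hk'⟩ := hQ
  refine ⟨k + k', fun l Q h => ?_⟩
  obtain ⟨m, n, P', Q', rfl, hm, hn⟩ := h.of_par _ _ rfl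
  exact add_le_add (hk _ _ hm) (hk' _ _ hn)

/-! ### The commutative monoids of processes -/

/-- The two behavioural equivalences under consideration. -/
inductive Semantics where
  | branching
  | weak

/-- Behavioural equivalence: branching bisimilarity or weak bisimilarity. -/
def Beh : Semantics → Proc Act → Proc Act → Prop
  | .branching => BranchingBisimilar
  | .weak => WeaklyBisimilar

theorem beh_equivalence (s : Semantics) : Equivalence (Beh (Act := Act) s) := by
  cases s
  · exact branchingBisimilar_equivalence
  · exact weaklyBisimilar_equivalence

theorem Beh.of_branching {P Q : Proc Act} (s : Semantics) (h : BranchingBisimilar P Q) :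
    Beh s P Q := by
  cases s
  · exact h
  · exact h.weaklyBisimilar

theorem Beh.par {s : Semantics} {P₁ P₂ Q₁ Q₂ : Proc Act} (h₁ : Beh s P₁ Q₁)
    (h₂ : Beh s P₂ Q₂) : Beh s (.par P₁ P₂) (.par Q₁ Q₂) := by
  cases s
  · exact BranchingBisimilar.par h₁ h₂
  · exact WeaklyBisimilar.par h₁ h₂

/-- Behavioural equivalence as a setoid. -/
def behSetoid (Act : Type u) (s : Semantics) : Setoid (Proc Act) :=
  ⟨Beh s, beh_equivalence s⟩

/-- Process expressions modulo branching (or weak) bisimilarity. -/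
def PROC (Act : Type u) (s : Semantics) : Type u :=
  Quotient (behSetoid Act s)

/-- The equivalence class of a process expression. -/
def cls (s : Semantics) (P : Proc Act) : PROC Act s :=
  Quotient.mk (behSetoid Act s) P

/-- Parallel composition of equivalence classes, written multiplicatively; the identity element
is the class of `nil`. -/
instance (s : Semantics) : CommMonoid (PROC Act s) where
  mul := Quotient.map₂ Proc.par (fun _ _ h₁ _ _ h₂ => Beh.par h₁ h₂)
  one := cls s .nil
  mul_assoc := by
    rintro ⟨P⟩ ⟨Q⟩ ⟨T⟩
    exact Quotient.sound (Beh.of_branching s (branchingBisimilar_par_assoc P Q T))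
  mul_comm := by
    rintro ⟨P⟩ ⟨Q⟩
    exact Quotient.sound (Beh.of_branching s (branchingBisimilar_par_comm P Q))
  one_mul := by
    rintro ⟨P⟩
    exact Quotient.sound (Beh.of_branching s (branchingBisimilar_equivalence.trans
      (branchingBisimilar_par_comm .nil P) (branchingBisimilar_par_nil P)))
  mul_one := by
    rintro ⟨P⟩
    exact Quotient.sound (Beh.of_branching s (branchingBisimilar_par_nil P))

theorem cls_par (s : Semantics) (P Q : Proc Act) : cls s (.par P Q) = cls s P * cls s Q :=
  rfl

/-- The commutative submonoid of (classes of) weakly bounded process expressions. -/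
def PROCfin (Act : Type u) (s : Semantics) : Submonoid (PROC Act s) where
  carrier := {x | ∃ P : Proc Act, cls s P = x ∧ WeaklyBounded P}
  one_mem' := ⟨.nil, rfl, weaklyBounded_nil⟩
  mul_mem' := by
    rintro _ _ ⟨P, rfl, hP⟩ ⟨Q, rfl, hQ⟩
    exact ⟨.par P Q, rfl, hP.par hQ⟩

/-- The transition relation on equivalence classes. -/
def ClsStep {s : Semantics} (x x' : PROC Act s) : Prop :=
  ∃ (Q Q' : Proc Act) (α : Option Act), cls s Q = x ∧ cls s Q' = x' ∧ Step Q α Q'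

/-- The order induced by the transition relation: `Ord x y` if `x` is reachable from `y`. -/
def Ord {s : Semantics} (x y : PROC Act s) : Prop :=
  Relation.ReflTransGen ClsStep y x

/-- The restriction of the order `Ord` to weakly bounded processes. -/
def OrdFin (Act : Type u) (s : Semantics) (x y : PROCfin Act s) : Prop :=
  Ord x.1 y.1

end BCCS

/-! ### Weak decomposition orders -/

namespace DecompositionTheory

universe u

variable {M : Type u} [CommMonoid M]

/-- Indecomposable elements of a commutative monoid. -/
def IsIndecomposable (p : M) : Prop :=
  p ≠ 1 ∧ ∀ x y : M, p = x * y → x = 1 ∨ y = 1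

/-- The strict part of an order. -/
def Strict (le : M → M → Prop) (x y : M) : Prop :=
  le x y ∧ x ≠ y

/-- Weak decomposition orders on a commutative monoid. -/
structure IsWeakDecompositionOrder (le : M → M → Prop) : Prop where
  refl : ∀ x, le x x
  trans : ∀ x y z, le x y → le y z → le x z
  antisymm : ∀ x y, le x y → le y x → x = y
  wellFounded : ∀ S : Set M, S.Nonempty → ∃ m ∈ S, ∀ x ∈ S, ¬ Strict le x m
  one_le : ∀ x, le 1 x
  compatible : ∀ x y z, le x y → le (x * z) (y * z)
  precompositional : ∀ x y z, le x (y * z) → ∃ y' z', le y' y ∧ le z' z ∧ x = y' * z'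
  archimedean : ∀ x y, (∀ n : ℕ, le (x ^ n) y) → x = 1

/-- Power cancellation, for an order on a commutative monoid. -/
def PowerCancellation (le : M → M → Prop) : Prop :=
  ∀ x y p : M, IsIndecomposable p → ¬ Strict le p x → ¬ Strict le p y →
    ∀ k : ℕ, p ^ k * x = p ^ k * y → x = y

end DecompositionTheory

/-! Order axioms. A transition either leaves an expression unchanged (a star loop) or shrinks it, so
a class below `y` is `y` itself or has a representative smaller than every representative of `y`;
this gives antisymmetry and well-foundedness. A weakly bounded process never returns to its own
class by a visible action, so following visible actions shrinks it until none is possible, and what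
remains is equivalent to `nil`. Precompositionality holds because parallel components evolve
independently. If `X` can act visibly, then `X ^ (k + 1)` can do so `k + 1` times and is not below a
process bounded by `k`.

Power cancellation. The pairs `(x, y)` with `p ^ k * x = p ^ k * y` and `p` strictly below neither
form a bisimulation. A step of `x` becomes a step of `p ^ k * x`, hence is matched by a move of `p ^
k * y`. Either this is essentially a move of `y` with `p ^ k` intact (`move_pow_mul`), or fewer than
`k` copies of `p` survive. The latter would give `p ^ k = p ^ i * w` with `i < k` and `p` not below
`w`. That this is impossible (`pow_ne_pow_mul`) is proved by induction on `k`, using cancellation of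
`p ^ k` itself to pass to `k + 1`. No unique decomposition theorem is needed.

The argument sees only the axioms of `IsMoveSystem`, so it serves both semantics at once. -/

namespace DecompositionTheory

universe u v

variable {M : Type u} [CommMonoid M] {le : M → M → Prop}

/-! ### Indecomposables and their powers in a weak decomposition order -/

namespace IsWeakDecompositionOrder

theorem compatible_left (h : IsWeakDecompositionOrder le) {x y : M} (z : M) (hxy : le x y) :
    le (z * x) (z * y) := by
  rw [mul_comm z x, mul_comm z y]
  exact h.compatible _ _ _ hxy

theorem le_mul_right (h : IsWeakDecompositionOrder le) (x y : M) : le x (x * y) := by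
  simpa using h.compatible_left x (h.one_le y)

/-- An indecomposable below a product is below one of the factors. -/
theorem le_or_le_of_le_mul (h : IsWeakDecompositionOrder le) {p x y : M}
    (hp : IsIndecomposable p) (hle : le p (x * y)) : le p x ∨ le p y := by
  obtain ⟨x', y', hx, hy, rfl⟩ := h.precompositional _ _ _ hle
  rcases hp.2 _ _ rfl with rfl | rfl
  · exact Or.inr (by simpa using hy)
  · exact Or.inl (by simpa using hx)

theorem not_le_one (h : IsWeakDecompositionOrder le) {p : M} (hp : IsIndecomposable p) :
    ¬ le p 1 :=
  fun hle => hp.1 (h.antisymm _ _ hle (h.one_le p))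

/-- Elements below a power of an indecomposable `p` are a smaller power of `p` times
an element that is not above `p`. -/
theorem exists_of_le_pow (h : IsWeakDecompositionOrder le) {p : M} (hp : IsIndecomposable p)
    (k : ℕ) : ∀ a, le a (p ^ k) → ∃ i ≤ k, ∃ w, ¬ le p w ∧ a = p ^ i * w := by
  induction k with
  | zero =>
    intro a ha
    refine ⟨0, le_rfl, 1, h.not_le_one hp, ?_⟩
    rw [pow_zero] at ha
    simpa using h.antisymm _ _ ha (h.one_le a)
  | succ k ih =>
    intro a ha
    rw [pow_succ] at ha
    obtain ⟨b, q, hb, hq, rfl⟩ := h.precompositional _ _ _ ha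
    obtain ⟨i, hi, w, hw, rfl⟩ := ih b hb
    -- Since `q` is below `p`, it is either `p` itself, one more counted copy, or not above `p`, and
    -- is absorbed into the remainder.
    by_cases hpq : le p q
    · obtain rfl := h.antisymm _ _ hpq hq
      exact ⟨i + 1, by omega, w, hw, by rw [pow_succ, mul_right_comm]⟩
    · refine ⟨i, by omega, w * q, ?_, mul_assoc _ _ _⟩
      exact fun hle => (h.le_or_le_of_le_mul hp hle).elim hw hpq

/-- If `p ^ k * x` has the form `p ^ i * w` with `w` not above `p`, then so does `p ^ k`. -/
theorem pow_eq_of_pow_mul_eq (h : IsWeakDecompositionOrder le) {p : M}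
    (hp : IsIndecomposable p) {k i : ℕ} {x w : M} (hw : ¬ le p w)
    (he : p ^ k * x = p ^ i * w) : ∃ j ≤ i, ∃ v, ¬ le p v ∧ p ^ k = p ^ j * v := by
  -- `p ^ k` is below `p ^ k * x = p ^ i * w`, so it splits into a part below `p ^ i` and a part
  -- below `w`; the latter cannot be above `p`.
  have hle : le (p ^ k) (p ^ i * w) := he ▸ h.le_mul_right _ _
  obtain ⟨a, w', ha, hw', he'⟩ := h.precompositional _ _ _ hle
  obtain ⟨j, hj, v, hv, rfl⟩ := h.exists_of_le_pow hp i a ha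
  refine ⟨j, hj, v * w', fun hle => ?_, by rw [he', mul_assoc]⟩
  exact (h.le_or_le_of_le_mul hp hle).elim hv fun hpw => hw (h.trans _ _ _ hpw hw')

end IsWeakDecompositionOrder

/-- An abstract account of the transitions and matching moves in a weak decomposition order.
`step α x x'` is a transition, and `move α x u v` says that `x` can match an `α`-transition by
passing through `u` and ending in `v`. -/
structure IsMoveSystem {A : Type v} (le : M → M → Prop) (τ : A) (step : A → M → M → Prop)
    (move : A → M → M → M → Prop) : Prop where
  move_le : ∀ α x u v, move α x u v → le u x ∧ le v u
  silent : ∀ α x u, move α x u x → α = τ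
  move_mul : ∀ α x y u v, move α (x * y) u v → ∃ u₁ u₂ v₁ v₂, u = u₁ * u₂ ∧ v = v₁ * v₂ ∧
    ((move α x u₁ v₁ ∧ move τ y u₂ v₂) ∨ (move τ x u₁ v₁ ∧ move α y u₂ v₂))
  step_le : ∀ α x x', step α x x' → le x' x
  move_of_step : ∀ α x x', step α x x' → move α x x x'
  step_mul : ∀ α x x' z, step α x x' → step α (z * x) (z * x')
  coinduction : ∀ R : M → M → Prop, (∀ x y, R x y → R y x) →
    (∀ x y α x', R x y → step α x x' → ∃ u v, move α y u v ∧ R x u ∧ R x' v) →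
    ∀ x y, R x y → x = y

/-! ### Power cancellation from a move system -/

namespace IsMoveSystem

variable {A : Type v} {τ : A} {step : A → M → M → Prop} {move : A → M → M → M → Prop}

/-- A move of `p ^ k * y` is a move of `y`, unless it destroys an occurrence of `p`. -/
theorem move_pow_mul (hs : IsMoveSystem le τ step move) (h : IsWeakDecompositionOrder le)
    {p : M} (hp : IsIndecomposable p) {y : M} (hy : ¬ Strict le p y) (k : ℕ) :
    ∀ α u v, move α (p ^ k * y) u v →
      (∃ u' v', move α y u' v' ∧ u = p ^ k * u' ∧ v = p ^ k * v') ∨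
      ∃ i < k, ∃ w, ¬ le p w ∧ v = p ^ i * w := by
  induction k with
  | zero =>
    intro α u v hm
    rw [pow_zero, one_mul] at hm
    exact Or.inl ⟨u, v, hm, by simp, by simp⟩
  | succ k ih =>
    intro α u v hm
    -- One copy of `p` is split off: the product is regrouped as `(p ^ k * y) * p`.
    rw [pow_succ, mul_right_comm] at hm
    obtain ⟨u₁, u₂, v₁, v₂, rfl, rfl, hsplit⟩ := hs.move_mul _ _ _ _ _ hm
    obtain ⟨β, γ, hm₁, hm₂, hβγ⟩ : ∃ β γ, move β (p ^ k * y) u₁ v₁ ∧ move γ p u₂ v₂ ∧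
        ((β = α ∧ γ = τ) ∨ (β = τ ∧ γ = α)) := by
      rcases hsplit with ⟨h₁, h₂⟩ | ⟨h₁, h₂⟩
      · exact ⟨_, _, h₁, h₂, Or.inl ⟨rfl, rfl⟩⟩
      · exact ⟨_, _, h₁, h₂, Or.inr ⟨rfl, rfl⟩⟩
    obtain ⟨hu₂, hv₂⟩ := hs.move_le _ _ _ _ hm₂
    -- If the split-off copy ends in an element not above `p`, it joins the remainder and
    -- contributes no copy of `p`.
    have hbad : ∀ i ≤ k, ∀ w, ¬ le p w → ¬ le p v₂ → v₁ = p ^ i * w →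
        ∃ i < k + 1, ∃ w, ¬ le p w ∧ v₁ * v₂ = p ^ i * w := by
      rintro i hi w hw hpv rfl
      refine ⟨i, by omega, w * v₂, fun hle => ?_, mul_assoc _ _ _⟩
      exact (h.le_or_le_of_le_mul hp hle).elim hw hpv
    rcases ih _ _ _ hm₁ with ⟨u', v', hm', rfl, rfl⟩ | ⟨i, hi, w, hw, rfl⟩
    -- Here `p ≤ v₂ ≤ u₂ ≤ p`, so the split-off copy is idle. By `silent` its label is `τ`, and the
    -- other factor carries `α`.
    · by_cases hpv : le p v₂
      · obtain rfl := h.antisymm _ _ hpv (h.trans _ _ _ hv₂ hu₂)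
        obtain rfl := h.antisymm _ _ hv₂ hu₂
        have hγ := hs.silent _ _ _ hm₂
        have hβ : β = α := by
          rcases hβγ with ⟨h₁, _⟩ | ⟨h₁, h₂⟩
          · exact h₁
          · rw [h₁, ← h₂, hγ]
        subst hβ
        exact Or.inl ⟨u', v', hm', by rw [pow_succ, mul_right_comm],
          by rw [pow_succ, mul_right_comm]⟩
      -- The split-off copy is lost, but `y` may replace it: if `p ≤ v' ≤ y`, then `p = y` because
      -- `p` is not strictly below `y`. So `y` is idle, and the move of the split-off copy counts as
      -- the move of `y`.
      · by_cases hpv' : le p v'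
        · obtain ⟨hu', hv'⟩ := hs.move_le _ _ _ _ hm'
          obtain rfl : p = y := by
            by_contra hne
            exact hy ⟨h.trans _ _ _ hpv' (h.trans _ _ _ hv' hu'), hne⟩
          obtain rfl := h.antisymm _ _ hpv' (h.trans _ _ _ hv' hu')
          obtain rfl := h.antisymm _ _ hv' hu'
          have hβ := hs.silent _ _ _ hm'
          have hγ : γ = α := by
            rcases hβγ with ⟨h₁, h₂⟩ | ⟨_, h₂⟩
            · rw [h₂, ← h₁, hβ]
            · exact h₂
          subst hγ
          exact Or.inl ⟨u₂, v₂, hm₂, by rw [pow_succ], by rw [pow_succ]⟩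
        · exact Or.inr (hbad k le_rfl v' hpv' hpv rfl)
    · by_cases hpv : le p v₂
      · obtain rfl := h.antisymm _ _ hpv (h.trans _ _ _ hv₂ hu₂)
        exact Or.inr ⟨i + 1, by omega, w, hw, by rw [pow_succ, mul_right_comm]⟩
      · exact Or.inr (hbad i hi.le w hw hpv rfl)

/-- Cancellation of `p ^ k`, if the number of occurrences of `p` in `p ^ k` is well-defined. -/
theorem eq_of_pow_mul_eq (hs : IsMoveSystem le τ step move) (h : IsWeakDecompositionOrder le)
    {p : M} (hp : IsIndecomposable p) {k : ℕ}
    (hk : ∀ i < k, ∀ w, ¬ le p w → p ^ k ≠ p ^ i * w) {x y : M}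
    (hx : ¬ Strict le p x) (hy : ¬ Strict le p y) (hxy : p ^ k * x = p ^ k * y) : x = y := by
  have hdown : ∀ {a b : M}, ¬ Strict le p b → le a b → ¬ Strict le p a := by
    rintro a b hb hab ⟨hpa, hne⟩
    refine hb ⟨h.trans _ _ _ hpa hab, ?_⟩
    rintro rfl
    exact hne (h.antisymm _ _ hpa hab)
  refine hs.coinduction
    (fun x y => p ^ k * x = p ^ k * y ∧ ¬ Strict le p x ∧ ¬ Strict le p y) ?_ ?_ x y
    ⟨hxy, hx, hy⟩
  · rintro x y ⟨h₁, h₂, h₃⟩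
    exact ⟨h₁.symm, h₃, h₂⟩
  · rintro x y α x' ⟨hxy, hx, hy⟩ hstep
    -- The move obtained passes through `p ^ k * x` itself, so the intermediate state `u` of `y` is
    -- again related to `x`, as branching bisimulation demands.
    have hm := hs.move_of_step _ _ _ (hs.step_mul _ _ _ (p ^ k) hstep)
    have hm' : move α (p ^ k * y) (p ^ k * x) (p ^ k * x') := hxy ▸ hm
    rcases hs.move_pow_mul h hp hy k _ _ _ hm' with ⟨u, v, hmy, hu, hv⟩ | ⟨i, hi, w, hw, he⟩
    · obtain ⟨huy, hvu⟩ := hs.move_le _ _ _ _ hmy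
      exact ⟨u, v, hmy, ⟨hu, hx, hdown hy huy⟩, ⟨hv, hdown hx (hs.step_le _ _ _ hstep),
        hdown hy (h.trans _ _ _ hvu huy)⟩⟩
    · obtain ⟨j, hj, v, hv, he'⟩ := h.pow_eq_of_pow_mul_eq hp hw he
      exact absurd he' (hk j (by omega) v hv)

/-- The number of occurrences of an indecomposable `p` in `p ^ k` is well-defined. -/
theorem pow_ne_pow_mul (hs : IsMoveSystem le τ step move) (h : IsWeakDecompositionOrder le)
    {p : M} (hp : IsIndecomposable p) (k : ℕ) :
    ∀ i < k, ∀ w, ¬ le p w → p ^ k ≠ p ^ i * w := by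
  induction k with
  | zero => exact fun i hi => absurd hi (Nat.not_lt_zero i)
  | succ k ih =>
    intro i hi w hw he
    rw [pow_succ] at he
    obtain ⟨j, hj, v, hv, he'⟩ := h.pow_eq_of_pow_mul_eq hp hw he
    -- `p ^ k` has the form `p ^ j * v` with `j ≤ i ≤ k`; the induction hypothesis excludes `j < k`,
    -- which forces `i = k`.
    obtain rfl : i = k := by
      by_contra hne
      exact ih j (by omega) v hv he'
    -- Now `p ^ k * p = p ^ k * w`, and `ih` is exactly what cancelling `p ^ k` requires.
    have hpw := hs.eq_of_pow_mul_eq h hp ih (fun hs => hs.2 rfl) (fun hs => hw hs.1) he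
    exact hw (hpw ▸ h.refl p)

theorem powerCancellation (hs : IsMoveSystem le τ step move)
    (h : IsWeakDecompositionOrder le) : PowerCancellation le :=
  fun _ _ _ hp hx hy k he => hs.eq_of_pow_mul_eq h hp (hs.pow_ne_pow_mul h hp k) hx hy he

end IsMoveSystem

end DecompositionTheory

namespace BCCS

universe u

variable {Act : Type u} {s : Semantics}

/-! ### Reachability -/

/-- Reachability by arbitrary transitions. -/
def Reach : Proc Act → Proc Act → Prop :=
  Relation.ReflTransGen (fun P P' => ∃ α, Step P α P')

theorem SilentSteps.reach {P P' : Proc Act} (h : SilentSteps P P') : Reach P P' :=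
  by
  induction h with
  | refl => exact Relation.ReflTransGen.refl
  | tail _ hs ih => exact ih.tail ⟨none, hs⟩

theorem OptStep.reach {P P' : Proc Act} {α : Option Act} (h : OptStep P α P') :
    Reach P P' := by
  rcases h with h | ⟨_, rfl⟩
  · exact Relation.ReflTransGen.single ⟨α, h⟩
  · exact Relation.ReflTransGen.refl

/-- The size of a process expression. -/
def Proc.size : Proc Act → ℕ
  | .nil => 0
  | .pre _ P => P.size + 1
  | .alt P Q => P.size + Q.size + 1
  | .par P Q => P.size + Q.size
  | .star _ P => P.size + 1

/-- Only a star loop, possibly inside a parallel context, fails to shrink an expression, and it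
returns to the same expression. Every other constructor that is passed loses its weight of one. -/
theorem Step.eq_or_size_lt {P P' : Proc Act} {α : Option Act} (h : Step P α P') :
    P' = P ∨ P'.size < P.size := by
  induction h with
  | pre α P => exact Or.inr (Nat.lt_succ_self _)
  | altLeft Q _ ih =>
    right
    rcases ih with rfl | ih <;> simp only [Proc.size] <;> omega
  | altRight Q _ ih =>
    right
    rcases ih with rfl | ih <;> simp only [Proc.size] <;> omega
  | parLeft Q _ ih =>
    rcases ih with rfl | ih
    · exact Or.inl rfl
    · right
      simp only [Proc.size]
      omega
  | parRight Q _ ih =>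
    rcases ih with rfl | ih
    · exact Or.inl rfl
    · right
      simp only [Proc.size]
      omega
  | starLoop α P => exact Or.inl rfl
  | starExit α _ ih =>
    right
    rcases ih with rfl | ih <;> simp only [Proc.size] <;> omega

theorem Reach.eq_or_size_lt {P P' : Proc Act} (h : Reach P P') :
    P' = P ∨ P'.size < P.size := by
  induction h with
  | refl => exact Or.inl rfl
  | tail _ hs ih =>
    obtain ⟨α, hs⟩ := hs
    rcases hs.eq_or_size_lt with rfl | h
    · exact ih
    · rcases ih with rfl | ih
      · exact Or.inr h
      · exact Or.inr (h.trans ih)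

theorem Reach.of_par {P Q X : Proc Act} (h : Reach (.par P Q) X) :
    ∃ P' Q', X = .par P' Q' ∧ Reach P P' ∧ Reach Q Q' := by
  induction h with
  | refl => exact ⟨P, Q, rfl, Relation.ReflTransGen.refl, Relation.ReflTransGen.refl⟩
  | tail _ hs ih =>
    obtain ⟨P', Q', rfl, h1, h2⟩ := ih
    obtain ⟨α, hs⟩ := hs
    cases hs with
    | parLeft _ hs => exact ⟨_, _, rfl, h1.tail ⟨α, hs⟩, h2⟩
    | parRight _ hs => exact ⟨_, _, rfl, h1, h2.tail ⟨α, hs⟩⟩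

theorem WeakPath.of_step {P P' Q : Proc Act} {α : Option Act} {l : ℕ} (h : Step P α P')
    (h' : WeakPath P' l Q) : ∃ l' Q', l ≤ l' ∧ WeakPath P l' Q' := by
  cases α with
  | none =>
    obtain ⟨Q', hQ'⟩ := h'.of_silentSteps (Relation.ReflTransGen.single h)
    exact ⟨l, Q', le_rfl, hQ'⟩
  | some a =>
    exact ⟨l + 1, Q, Nat.le_succ l,
      .cons ⟨P, P', Relation.ReflTransGen.refl, h, Relation.ReflTransGen.refl⟩ h'⟩

theorem WeaklyBoundedBy.reach {k : ℕ} {P P' : Proc Act} (hP : WeaklyBoundedBy k P)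
    (h : Reach P P') : WeaklyBoundedBy k P' := by
  induction h with
  | refl => exact hP
  | tail _ hs ih =>
    obtain ⟨α, hs⟩ := hs
    intro l Q hl
    obtain ⟨l', Q', hle, hl'⟩ := hl.of_step hs
    exact hle.trans (ih _ _ hl')

theorem WeaklyBounded.reach {P P' : Proc Act} (hP : WeaklyBounded P) (h : Reach P P') :
    WeaklyBounded P' :=
  let ⟨k, hk⟩ := hP
  ⟨k, hk.reach h⟩

/-! ### Matching moves -/

/-- The moves by which a process can match an `α`-transition: in branching semantics `P` silently
reaches `P''` and then performs `α` (or nothing, if `α` is silent); in weak semantics the `α` is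
surrounded by silent transitions, and there is no intermediate process to keep track of. -/
def Move (s : Semantics) (α : Option Act) (P P'' P' : Proc Act) : Prop :=
  match s with
  | .branching => SilentSteps P P'' ∧ OptStep P'' α P'
  | .weak => P'' = P ∧ ∃ S T, SilentSteps P S ∧ OptStep S α T ∧ SilentSteps T P'

theorem Move.of_step {α : Option Act} {P P' : Proc Act} (h : Step P α P') :
    Move s α P P P' := by
  cases s
  · exact ⟨Relation.ReflTransGen.refl, Or.inl h⟩
  · exact ⟨rfl, P, P', Relation.ReflTransGen.refl, Or.inl h, Relation.ReflTransGen.refl⟩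

theorem Move.reach {α : Option Act} {P P'' P' : Proc Act} (h : Move s α P P'' P') :
    Reach P P'' ∧ Reach P'' P' := by
  cases s
  · exact ⟨h.1.reach, h.2.reach⟩
  · obtain ⟨rfl, S, T, h1, h2, h3⟩ := h
    exact ⟨Relation.ReflTransGen.refl, h1.reach.trans (h2.reach.trans h3.reach)⟩

theorem Move.weakStep {a : Act} {P P'' P' : Proc Act} (h : Move s (some a) P P'' P') :
    WeakStep P a P' := by
  cases s
  · obtain ⟨h1, h2 | ⟨h2, _⟩⟩ := h
    · exact ⟨_, _, h1, h2, Relation.ReflTransGen.refl⟩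
    · cases h2
  · obtain ⟨rfl, S, T, h1, h2 | ⟨h2, _⟩, h3⟩ := h
    · exact ⟨_, _, h1, h2, h3⟩
    · cases h2

/-- There is no communication, so the `α`-transition belongs to one component, while the silent
steps of the other form a `τ`-move of their own. -/
theorem Move.of_par {α : Option Act} {P Q U V : Proc Act} (h : Move s α (.par P Q) U V) :
    ∃ P'' Q'' P' Q', U = .par P'' Q'' ∧ V = .par P' Q' ∧
      ((Move s α P P'' P' ∧ Move s none Q Q'' Q') ∨
        (Move s none P P'' P' ∧ Move s α Q Q'' Q')) := by
  cases s
  · obtain ⟨h1, h2⟩ := h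
    obtain ⟨P'', Q'', rfl, hP, hQ⟩ := h1.of_par
    rcases h2 with h2 | ⟨rfl, rfl⟩
    · cases h2 with
      | parLeft _ h2 =>
        exact ⟨_, _, _, _, rfl, rfl, Or.inl ⟨⟨hP, Or.inl h2⟩, ⟨hQ, Or.inr ⟨rfl, rfl⟩⟩⟩⟩
      | parRight _ h2 =>
        exact ⟨_, _, _, _, rfl, rfl, Or.inr ⟨⟨hP, Or.inr ⟨rfl, rfl⟩⟩, ⟨hQ, Or.inl h2⟩⟩⟩
    · exact ⟨_, _, _, _, rfl, rfl,
        Or.inl ⟨⟨hP, Or.inr ⟨rfl, rfl⟩⟩, ⟨hQ, Or.inr ⟨rfl, rfl⟩⟩⟩⟩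
  · obtain ⟨rfl, S, T, h1, h2, h3⟩ := h
    obtain ⟨P₁, Q₁, rfl, hP₁, hQ₁⟩ := h1.of_par
    rcases h2 with h2 | ⟨rfl, rfl⟩
    · cases h2 with
      | parLeft _ h2 =>
        obtain ⟨P₃, Q₃, rfl, hP₃, hQ₃⟩ := h3.of_par
        exact ⟨_, _, _, _, rfl, rfl, Or.inl ⟨⟨rfl, _, _, hP₁, Or.inl h2, hP₃⟩,
          ⟨rfl, _, _, hQ₁, Or.inr ⟨rfl, rfl⟩, hQ₃⟩⟩⟩
      | parRight _ h2 =>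
        obtain ⟨P₃, Q₃, rfl, hP₃, hQ₃⟩ := h3.of_par
        exact ⟨_, _, _, _, rfl, rfl, Or.inr ⟨⟨rfl, _, _, hP₁, Or.inr ⟨rfl, rfl⟩, hP₃⟩,
          ⟨rfl, _, _, hQ₁, Or.inl h2, hQ₃⟩⟩⟩
    · obtain ⟨P₃, Q₃, rfl, hP₃, hQ₃⟩ := h3.of_par
      exact ⟨_, _, _, _, rfl, rfl, Or.inl ⟨⟨rfl, _, _, hP₁, Or.inr ⟨rfl, rfl⟩, hP₃⟩,
        ⟨rfl, _, _, hQ₁, Or.inr ⟨rfl, rfl⟩, hQ₃⟩⟩⟩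

/-- One coinduction principle for both semantics: in the weak case the intermediate process is `Q`
itself, so the condition on it is vacuous. -/
theorem beh_of_matching {R : Proc Act → Proc Act → Prop} (hsymm : ∀ P Q, R P Q → R Q P)
    (hR : ∀ P Q α P', R P Q → Step P α P' →
      ∃ Q'' Q', Move s α Q Q'' Q' ∧ R P Q'' ∧ R P' Q')
    {P Q : Proc Act} (h : R P Q) : Beh s P Q := by
  cases s
  · refine ⟨R, ⟨hsymm, fun P Q α P' h hs => ?_⟩, h⟩
    obtain ⟨Q'', Q', ⟨h1, h2⟩, h3, h4⟩ := hR _ _ _ _ h hs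
    exact ⟨Q'', Q', h1, h2, h3, h4⟩
  · refine ⟨R, ⟨hsymm, fun P Q α P' h hs => ?_⟩, h⟩
    obtain ⟨Q'', Q', ⟨_, S, T, h1, h2, h3⟩, _, h4⟩ := hR _ _ _ _ h hs
    exact ⟨S, T, Q', h1, h2, h3, h4⟩

theorem Beh.step {P Q P' : Proc Act} {α : Option Act} (h : Beh s P Q) (hs : Step P α P') :
    ∃ Q'' Q', Move s α Q Q'' Q' ∧ Beh s P Q'' ∧ Beh s P' Q' := by
  cases s
  · obtain ⟨R, hR, hPQ⟩ := h
    obtain ⟨Q'', Q', h1, h2, h3, h4⟩ := hR.2 _ _ _ _ hPQ hs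
    exact ⟨Q'', Q', ⟨h1, h2⟩, ⟨R, hR, h3⟩, ⟨R, hR, h4⟩⟩
  · have h' := h
    obtain ⟨R, hR, hPQ⟩ := h
    obtain ⟨S, T, Q', h1, h2, h3, h4⟩ := hR.2 _ _ _ _ hPQ hs
    exact ⟨Q, Q', ⟨rfl, S, T, h1, h2, h3⟩, h', ⟨R, hR, h4⟩⟩

theorem Beh.silentSteps {P Q P' : Proc Act} (h : Beh s P Q) (hs : SilentSteps P P') :
    ∃ Q', SilentSteps Q Q' ∧ Beh s P' Q' := by
  cases s
  · obtain ⟨R, hR, hPQ⟩ := h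
    obtain ⟨Q', h1, h2⟩ := hR.silentSteps hPQ hs
    exact ⟨Q', h1, R, hR, h2⟩
  · obtain ⟨R, hR, hPQ⟩ := h
    obtain ⟨Q', h1, h2⟩ := hR.silentSteps hPQ hs
    exact ⟨Q', h1, R, hR, h2⟩

/-- This makes moves of classes independent of the representative. -/
theorem Beh.move {P Q P'' P' : Proc Act} {α : Option Act} (h : Beh s P Q)
    (hm : Move s α P P'' P') :
    ∃ Q'' Q', Move s α Q Q'' Q' ∧ Beh s P'' Q'' ∧ Beh s P' Q' := by
  cases s
  · obtain ⟨h1, h2⟩ := hm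
    obtain ⟨Q₁, hQ₁, hb⟩ := h.silentSteps h1
    rcases h2 with h2 | ⟨rfl, rfl⟩
    · obtain ⟨Q'', Q', ⟨h3, h4⟩, h5, h6⟩ := hb.step h2
      exact ⟨Q'', Q', ⟨hQ₁.trans h3, h4⟩, h5, h6⟩
    · exact ⟨Q₁, Q₁, ⟨hQ₁, Or.inr ⟨rfl, rfl⟩⟩, hb, hb⟩
  · obtain ⟨rfl, S, T, h1, h2, h3⟩ := hm
    obtain ⟨Q₁, hQ₁, hb⟩ := h.silentSteps h1
    rcases h2 with h2 | ⟨rfl, rfl⟩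
    · obtain ⟨_, Q₂, ⟨_, S', T', h4, h5, h6⟩, _, h7⟩ := hb.step h2
      obtain ⟨Q₃, hQ₃, h8⟩ := h7.silentSteps h3
      exact ⟨Q, Q₃, ⟨rfl, S', T', hQ₁.trans h4, h5, h6.trans hQ₃⟩, h, h8⟩
    · obtain ⟨Q₃, hQ₃, h8⟩ := hb.silentSteps h3
      exact ⟨Q, Q₃, ⟨rfl, Q₁, Q₁, hQ₁, Or.inr ⟨rfl, rfl⟩, hQ₃⟩, h, h8⟩

theorem Beh.weakStep {P Q P' : Proc Act} {a : Act} (h : Beh s P Q) (hs : WeakStep P a P') :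
    ∃ Q', WeakStep Q a Q' ∧ Beh s P' Q' := by
  obtain ⟨P₁, P₂, h1, h2, h3⟩ := hs
  obtain ⟨Q₁, hQ₁, hb₁⟩ := h.silentSteps h1
  obtain ⟨_, Q₂, hm, _, hb₂⟩ := hb₁.step h2
  obtain ⟨Q₃, hQ₃, hb₃⟩ := hb₂.silentSteps h3
  obtain ⟨X, Y, h4, h5, h6⟩ := hm.weakStep
  exact ⟨Q₃, ⟨X, Y, hQ₁.trans h4, h5, h6.trans hQ₃⟩, hb₃⟩

theorem Beh.weakPath {P P' : Proc Act} {l : ℕ} (hp : WeakPath P l P') :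
    ∀ Q, Beh s P Q → ∃ Q', WeakPath Q l Q' := by
  induction hp with
  | refl P => exact fun Q _ => ⟨Q, .refl Q⟩
  | cons hs _ ih =>
    intro Q h
    obtain ⟨Q₁, hQ₁, hb⟩ := h.weakStep hs
    obtain ⟨Q', hQ'⟩ := ih Q₁ hb
    exact ⟨Q', .cons hQ₁ hQ'⟩

theorem Beh.reach {P Q P' : Proc Act} (h : Beh s P Q) (hr : Reach P P') :
    ∃ Q', Reach Q Q' ∧ Beh s P' Q' := by
  induction hr with
  | refl => exact ⟨Q, Relation.ReflTransGen.refl, h⟩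
  | tail _ hs ih =>
    obtain ⟨α, hs⟩ := hs
    obtain ⟨Q₁, hQ₁, hb⟩ := ih
    obtain ⟨Q'', Q', hm, _, hb'⟩ := hb.step hs
    exact ⟨Q', hQ₁.trans (hm.reach.1.trans hm.reach.2), hb'⟩

/-! ### Weakly bounded processes -/

/-- A weakly bounded process cannot return to its own class by a visible transition. -/
theorem WeaklyBounded.not_weakStep_beh {P P' : Proc Act} {a : Act} (hP : WeaklyBounded P)
    (h : WeakStep P a P') : ¬ Beh s P P' := by
  intro hb
  obtain ⟨k, hk⟩ := hP
  -- A visible return to the class can be repeated from every member of it, giving visible paths of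
  -- any length.
  have key : ∀ n Q, Beh s P Q → ∃ Q', WeakPath Q n Q' := by
    intro n
    induction n with
    | zero => exact fun Q _ => ⟨Q, .refl Q⟩
    | succ n ih =>
      intro Q hQ
      obtain ⟨Q₁, hQ₁, hb₁⟩ := hQ.weakStep h
      obtain ⟨Q', hQ'⟩ := ih Q₁ ((beh_equivalence s).trans hb hb₁)
      exact ⟨Q', .cons hQ₁ hQ'⟩
  obtain ⟨Q', hQ'⟩ := key (k + 1) P ((beh_equivalence s).refl P)
  exact absurd (hk _ _ hQ') (by omega)

/-- A process without visible behaviour is equivalent to `nil`. -/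
theorem beh_nil_of_not_weakStep {P : Proc Act} (hP : ∀ a P', ¬ WeakStep P a P') :
    Beh s P .nil := by
  -- Any two processes without visible behaviour are related; a silent step is matched by standing
  -- still.
  refine Beh.of_branching s ⟨fun P Q => (∀ a P', ¬ WeakStep P a P') ∧
    ∀ a Q', ¬ WeakStep Q a Q', ⟨fun P Q h => ⟨h.2, h.1⟩, ?_⟩, hP, ?_⟩
  · rintro P Q α P' ⟨hP, hQ⟩ hs
    cases α with
    | none =>
      refine ⟨Q, Q, Relation.ReflTransGen.refl, Or.inr ⟨rfl, rfl⟩, ⟨hP, hQ⟩, ?_, hQ⟩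
      rintro a X ⟨Y, Z, h1, h2, h3⟩
      exact hP a X ⟨Y, Z, Relation.ReflTransGen.head hs h1, h2, h3⟩
    | some a =>
      exact absurd ⟨P, P', Relation.ReflTransGen.refl, hs, Relation.ReflTransGen.refl⟩
        (hP a P')
  · rintro a X ⟨Y, Z, h1, h2, _⟩
    rcases Relation.ReflTransGen.cases_head h1 with rfl | ⟨Z', hZ, _⟩
    · cases h2
    · cases hZ

/-- Induction on size: a visible step cannot lead back to the same expression, so it leads to a
smaller one. Once no visible step is possible, the process is equivalent to `nil`. -/
theorem WeaklyBounded.exists_reach_nil (n : ℕ) : ∀ P : Proc Act, P.size < n →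
    WeaklyBounded P → ∃ P', Reach P P' ∧ Beh s P' .nil := by
  induction n with
  | zero => exact fun P h => absurd h (Nat.not_lt_zero _)
  | succ n ih =>
    intro P hn hP
    by_cases h : ∃ a P', WeakStep P a P'
    · obtain ⟨a, P', hs⟩ := h
      have hr : Reach P P' := by
        obtain ⟨X, Y, h1, h2, h3⟩ := hs
        exact h1.reach.trans ((Relation.ReflTransGen.single ⟨_, h2⟩).trans h3.reach)
      rcases hr.eq_or_size_lt with rfl | hlt
      · exact absurd ((beh_equivalence s).refl _) (hP.not_weakStep_beh hs)
      · obtain ⟨P'', hr', hb⟩ := ih P' (by omega) (hP.reach hr)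
        exact ⟨P'', hr.trans hr', hb⟩
    · push Not at h
      exact ⟨P, Relation.ReflTransGen.refl, beh_nil_of_not_weakStep h⟩

/-! ### The order on classes -/

theorem cls_eq_iff {P Q : Proc Act} : cls s P = cls s Q ↔ Beh s P Q :=
  ⟨fun h => Quotient.exact h, fun h => Quotient.sound h⟩

theorem exists_cls_eq (x : PROC Act s) : ∃ P, cls s P = x :=
  Quotient.exists_rep x

/-- A path of classes may change representative at each step, but bisimilarity transfers
reachability, so the whole path can be traced from one fixed representative. -/
theorem ord_cls_iff {x : PROC Act s} {P : Proc Act} :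
    Ord x (cls s P) ↔ ∃ P', Reach P P' ∧ cls s P' = x := by
  constructor
  · intro h
    unfold Ord at h
    induction h with
    | refl => exact ⟨P, Relation.ReflTransGen.refl, rfl⟩
    | tail _ hs ih =>
      obtain ⟨P', hr, rfl⟩ := ih
      obtain ⟨Q, Q', α, hQ, rfl, hs⟩ := hs
      obtain ⟨P'', hr', hb⟩ := (cls_eq_iff.1 hQ).reach (Relation.ReflTransGen.single ⟨α, hs⟩)
      exact ⟨P'', hr.trans hr', (cls_eq_iff.2 hb).symm⟩
  · rintro ⟨P', hr, rfl⟩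
    exact Relation.ReflTransGen.lift (cls s) (fun Q Q' ⟨α, hs⟩ => ⟨Q, Q', α, rfl, rfl, hs⟩) _ _ hr

/-- The least size of a representative. -/
noncomputable def rank (x : PROC Act s) : ℕ :=
  sInf {n | ∃ P, cls s P = x ∧ P.size = n}

theorem exists_size_eq_rank (x : PROC Act s) : ∃ P, cls s P = x ∧ P.size = rank x := by
  obtain ⟨P, hP⟩ := exists_cls_eq x
  exact Nat.sInf_mem (s := {n | ∃ P, cls s P = x ∧ P.size = n}) ⟨P.size, P, hP, rfl⟩

theorem rank_cls_le (P : Proc Act) : rank (cls s P) ≤ P.size :=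
  Nat.sInf_le ⟨P, rfl, rfl⟩

/-- Starting from a representative of `y` of least size, the expression reached is the same or
smaller. Antisymmetry and well-foundedness both follow. -/
theorem Ord.eq_or_rank_lt {x y : PROC Act s} (h : Ord x y) : x = y ∨ rank x < rank y := by
  obtain ⟨P, rfl, hP⟩ := exists_size_eq_rank y
  obtain ⟨P', hr, rfl⟩ := ord_cls_iff.1 h
  rcases hr.eq_or_size_lt with rfl | hlt
  · exact Or.inl rfl
  · exact Or.inr ((rank_cls_le P').trans_lt (hP ▸ hlt))

theorem ClsStep.mul_left {x x' : PROC Act s} (z : PROC Act s) (h : ClsStep x x') :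
    ClsStep (z * x) (z * x') := by
  obtain ⟨Q, Q', α, rfl, rfl, hs⟩ := h
  obtain ⟨Z, rfl⟩ := exists_cls_eq z
  exact ⟨.par Z Q, .par Z Q', α, rfl, rfl, Step.parRight Z hs⟩

theorem Ord.mul_left {x y : PROC Act s} (z : PROC Act s) (h : Ord x y) :
    Ord (z * x) (z * y) :=
  Relation.ReflTransGen.lift (z * ·) (fun _ _ hs => hs.mul_left z) _ _ h

theorem Ord.exists_of_mul {x y z : PROC Act s} (h : Ord x (y * z)) :
    ∃ y' z', Ord y' y ∧ Ord z' z ∧ x = y' * z' := by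
  obtain ⟨Y, rfl⟩ := exists_cls_eq y
  obtain ⟨Z, rfl⟩ := exists_cls_eq z
  rw [← cls_par, ord_cls_iff] at h
  obtain ⟨X, hr, rfl⟩ := h
  obtain ⟨Y', Z', rfl, hY, hZ⟩ := hr.of_par
  exact ⟨cls s Y', cls s Z', ord_cls_iff.2 ⟨Y', hY, rfl⟩, ord_cls_iff.2 ⟨Z', hZ, rfl⟩, rfl⟩

theorem Ord.mem_PROCfin {x y : PROC Act s} (h : Ord x y) (hy : y ∈ PROCfin Act s) :
    x ∈ PROCfin Act s := by
  obtain ⟨P, rfl, hP⟩ := hy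
  obtain ⟨P', hr, rfl⟩ := ord_cls_iff.1 h
  exact ⟨P', rfl, hP.reach hr⟩

/-- Each of the `n` parallel copies contributes one visible action; this drives the Archimedean
property. -/
theorem exists_weakPath_pow {X X' : Proc Act} {a : Act} (hX : WeakStep X a X') (n : ℕ) :
    ∃ P P', cls s P = cls s X ^ n ∧ WeakPath P n P' := by
  induction n with
  | zero => exact ⟨.nil, .nil, by rw [pow_zero]; rfl, .refl _⟩
  | succ n ih =>
    obtain ⟨P, P', hP, hp⟩ := ih
    refine ⟨.par P X, ?_⟩
    have hstep : WeakStep (.par P X) a (.par P X') := by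
      obtain ⟨Y, Z, h1, h2, h3⟩ := hX
      exact ⟨_, _, SilentSteps.parBoth Relation.ReflTransGen.refl h1, Step.parRight P h2,
        SilentSteps.parBoth Relation.ReflTransGen.refl h3⟩
    have hlift : ∀ {P P' : Proc Act} {l : ℕ}, WeakPath P l P' →
        WeakPath (.par P X') l (.par P' X') := by
      intro P P' l h
      induction h with
      | refl P => exact .refl _
      | cons hs _ ih =>
        obtain ⟨Y, Z, h1, h2, h3⟩ := hs
        exact .cons ⟨_, _, SilentSteps.parBoth h1 Relation.ReflTransGen.refl,
          Step.parLeft _ h2, SilentSteps.parBoth h3 Relation.ReflTransGen.refl⟩ ih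
    exact ⟨.par P' X', by rw [cls_par, hP, pow_succ], .cons hstep (hlift hp)⟩

theorem ordFin_isWeakDecompositionOrder (Act : Type u) (s : Semantics) :
    DecompositionTheory.IsWeakDecompositionOrder (OrdFin Act s) where
  refl _ := Relation.ReflTransGen.refl
  trans _ _ _ h h' := Relation.ReflTransGen.trans h' h
  antisymm x y h h' := by
    rcases Ord.eq_or_rank_lt h with he | hlt
    · exact Subtype.ext he
    · rcases Ord.eq_or_rank_lt h' with he | hlt'
      · exact Subtype.ext he.symm
      · omega
  wellFounded S hS := by
    obtain ⟨m, hm, hmin⟩ :=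
      (measure fun x : PROCfin Act s => rank x.1).wf.has_min S hS
    refine ⟨m, hm, fun x hx hs => ?_⟩
    rcases Ord.eq_or_rank_lt hs.1 with he | hlt
    · exact hs.2 (Subtype.ext he)
    · exact hmin x hx hlt
  one_le := by
    rintro ⟨_, P, rfl, hP⟩
    obtain ⟨P', hr, hb⟩ := hP.exists_reach_nil (s := s) (P.size + 1) P (Nat.lt_succ_self _)
    exact ord_cls_iff.2 ⟨P', hr, cls_eq_iff.2 hb⟩
  compatible x y z h := by
    rw [mul_comm x z, mul_comm y z]
    exact Ord.mul_left z.1 h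
  precompositional x y z h := by
    obtain ⟨y', z', hy, hz, he⟩ := Ord.exists_of_mul h
    exact ⟨⟨y', hy.mem_PROCfin y.2⟩, ⟨z', hz.mem_PROCfin z.2⟩, hy, hz, Subtype.ext he⟩
  archimedean := by
    rintro ⟨_, X, rfl, hX⟩ ⟨_, Y, rfl, k, hk⟩ h
    refine Subtype.ext (cls_eq_iff.2 (beh_nil_of_not_weakStep fun a X' hs => ?_))
    obtain ⟨P, P', hP, hp⟩ := exists_weakPath_pow (s := s) hs (k + 1)
    obtain ⟨Z, hr, hZ⟩ := ord_cls_iff.1 (h (k + 1))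
    have hb : Beh s P Z := cls_eq_iff.1 (hP.trans hZ.symm)
    -- `Z` is reachable from `Y`, hence bounded by `k`, yet it inherits `k + 1` visible actions from
    -- the power of `X`.
    obtain ⟨Z', hp'⟩ := Beh.weakPath hp Z hb
    exact absurd ((hk.reach hr) _ _ hp') (by omega)

/-! ### Moves of classes -/

/-- Labelled transitions between classes. -/
def ClsLabelledStep (α : Option Act) (x x' : PROC Act s) : Prop :=
  ∃ P P', cls s P = x ∧ cls s P' = x' ∧ Step P α P'

/-- Moves of classes. -/
def ClsMove (α : Option Act) (x u v : PROC Act s) : Prop :=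
  ∃ P P'' P', cls s P = x ∧ cls s P'' = u ∧ cls s P' = v ∧ Move s α P P'' P'

theorem clsMove_cls_iff {α : Option Act} {P : Proc Act} {u v : PROC Act s} :
    ClsMove α (cls s P) u v ↔
      ∃ P'' P', cls s P'' = u ∧ cls s P' = v ∧ Move s α P P'' P' := by
  constructor
  · rintro ⟨Q, Q'', Q', hQ, rfl, rfl, hm⟩
    obtain ⟨P'', P', hm', h1, h2⟩ := (cls_eq_iff.1 hQ).move hm
    exact ⟨P'', P', (cls_eq_iff.2 h1).symm, (cls_eq_iff.2 h2).symm, hm'⟩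
  · rintro ⟨P'', P', h1, h2, hm⟩
    exact ⟨P, P'', P', rfl, h1, h2, hm⟩

theorem ClsMove.ord {α : Option Act} {x u v : PROC Act s} (h : ClsMove α x u v) :
    Ord u x ∧ Ord v u := by
  obtain ⟨P, P'', P', rfl, rfl, rfl, hm⟩ := h
  exact ⟨ord_cls_iff.2 ⟨P'', hm.reach.1, rfl⟩, ord_cls_iff.2 ⟨P', hm.reach.2, rfl⟩⟩

theorem ClsMove.of_mul {α : Option Act} {x y u v : PROC Act s} (h : ClsMove α (x * y) u v) :
    ∃ u₁ u₂ v₁ v₂, u = u₁ * u₂ ∧ v = v₁ * v₂ ∧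
      ((ClsMove α x u₁ v₁ ∧ ClsMove none y u₂ v₂) ∨
        (ClsMove none x u₁ v₁ ∧ ClsMove α y u₂ v₂)) := by
  obtain ⟨P, rfl⟩ := exists_cls_eq x
  obtain ⟨Q, rfl⟩ := exists_cls_eq y
  rw [← cls_par, clsMove_cls_iff] at h
  obtain ⟨U, V, rfl, rfl, hm⟩ := h
  obtain ⟨P'', Q'', P', Q', rfl, rfl, hm'⟩ := hm.of_par
  refine ⟨cls s P'', cls s Q'', cls s P', cls s Q', rfl, rfl, hm'.imp ?_ ?_⟩
  · exact fun h => ⟨⟨_, _, _, rfl, rfl, rfl, h.1⟩, ⟨_, _, _, rfl, rfl, rfl, h.2⟩⟩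
  · exact fun h => ⟨⟨_, _, _, rfl, rfl, rfl, h.1⟩, ⟨_, _, _, rfl, rfl, rfl, h.2⟩⟩

/-- Boundedness is essential only for `silent`, where a visible move back to the same class must be
excluded; elsewhere it serves to stay inside the submonoid. -/
theorem ordFin_isMoveSystem (Act : Type u) (s : Semantics) :
    DecompositionTheory.IsMoveSystem (OrdFin Act s) (none : Option Act)
      (fun α x x' => ClsLabelledStep α x.1 x'.1) (fun α x u v => ClsMove α x.1 u.1 v.1) where
  move_le _ _ _ _ h := h.ord
  silent α x u h := by
    obtain ⟨_, P, rfl, hP⟩ := x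
    obtain ⟨P'', P', _, hP', hm⟩ := clsMove_cls_iff.1 h
    cases α with
    | none => rfl
    | some a => exact absurd (cls_eq_iff.1 hP'.symm) (hP.not_weakStep_beh hm.weakStep)
  move_mul α x y u v h := by
    obtain ⟨u₁, u₂, v₁, v₂, hu, hv, hm⟩ := ClsMove.of_mul h
    have hmem : (Ord u₁ x.1 ∧ Ord v₁ u₁) ∧ (Ord u₂ y.1 ∧ Ord v₂ u₂) := by
      rcases hm with ⟨h1, h2⟩ | ⟨h1, h2⟩
      · exact ⟨h1.ord, h2.ord⟩
      · exact ⟨h1.ord, h2.ord⟩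
    obtain ⟨⟨h1, h2⟩, h3, h4⟩ := hmem
    have hu₁ := h1.mem_PROCfin x.2
    have hu₂ := h3.mem_PROCfin y.2
    exact ⟨⟨u₁, hu₁⟩, ⟨u₂, hu₂⟩, ⟨v₁, h2.mem_PROCfin hu₁⟩, ⟨v₂, h4.mem_PROCfin hu₂⟩,
      Subtype.ext hu, Subtype.ext hv, hm⟩
  step_le := by
    rintro α x x' ⟨P, P', hP, hP', hs⟩
    exact Relation.ReflTransGen.single ⟨P, P', α, hP, hP', hs⟩
  move_of_step := by
    rintro α x x' ⟨P, P', hP, hP', hs⟩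
    exact ⟨P, P, P', hP, hP, hP', Move.of_step hs⟩
  step_mul := by
    rintro α x x' z ⟨P, P', hP, hP', hs⟩
    obtain ⟨Z, hZ⟩ := exists_cls_eq z.1
    refine ⟨.par Z P, .par Z P', ?_, ?_, Step.parRight Z hs⟩
    · rw [cls_par, hZ, hP]; rfl
    · rw [cls_par, hZ, hP']; rfl
  coinduction R hsymm hR := by
    rintro ⟨_, P, rfl, hP⟩ ⟨_, Q, rfl, hQ⟩ h
    -- `R` is pulled back to expressions whose classes lie in the submonoid; closure of the
    -- submonoid under transitions keeps the matching inside it.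
    refine Subtype.ext (cls_eq_iff.2 (beh_of_matching (R := fun P Q =>
      ∃ (hP : cls s P ∈ PROCfin Act s) (hQ : cls s Q ∈ PROCfin Act s),
        R ⟨cls s P, hP⟩ ⟨cls s Q, hQ⟩) ?_ ?_ ⟨_, _, h⟩))
    · rintro P Q ⟨hP, hQ, h⟩
      exact ⟨hQ, hP, hsymm _ _ h⟩
    · rintro P Q α P' ⟨hP, hQ, h⟩ hs
      have hP' : cls s P' ∈ PROCfin Act s :=
        (ord_cls_iff.2 ⟨P', Relation.ReflTransGen.single ⟨α, hs⟩, rfl⟩ :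
          Ord (cls s P') (cls s P)).mem_PROCfin hP
      obtain ⟨⟨u, hu⟩, ⟨v, hv⟩, hm, h1, h2⟩ :=
        hR _ _ α ⟨cls s P', hP'⟩ h ⟨P, P', rfl, rfl, hs⟩
      obtain ⟨Q'', Q', rfl, rfl, hm'⟩ := clsMove_cls_iff.1 hm
      exact ⟨Q'', Q', hm', ⟨hP, hu, h1⟩, ⟨hP', hv, h2⟩⟩

end BCCS

theorem mainTheorem3 (Act : Type*) :
    (DecompositionTheory.IsWeakDecompositionOrder
        (BCCS.OrdFin Act BCCS.Semantics.branching) ∧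
      DecompositionTheory.PowerCancellation
        (BCCS.OrdFin Act BCCS.Semantics.branching)) ∧
    (DecompositionTheory.IsWeakDecompositionOrder
        (BCCS.OrdFin Act BCCS.Semantics.weak) ∧
      DecompositionTheory.PowerCancellation
        (BCCS.OrdFin Act BCCS.Semantics.weak)) := by
  have key : ∀ s, DecompositionTheory.IsWeakDecompositionOrder (BCCS.OrdFin Act s) ∧
      DecompositionTheory.PowerCancellation (BCCS.OrdFin Act s) := fun s =>
    ⟨BCCS.ordFin_isWeakDecompositionOrder Act s,
      (BCCS.ordFin_isMoveSystem Act s).powerCancellation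
        (BCCS.ordFin_isWeakDecompositionOrder Act s)⟩
  exact ⟨key _, key _⟩
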